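/- A countable Borel equivalence relation (CBER) on a standard Borel space $X$ is an equivalence relation $E\subseteq X\times X$ that is Borel and has countable classes. Let $\mathrm{Aut}_B(E)$ be the group of Borel automorphisms $T$ of $X$ with $x\mathrel{E}y\iff T(x)\mathrel{E}T(y)$, let $\mathrm{Inn}_B(E)$ be its normal subgroup of those $T$ with $x\mathrel{E}T(x)$ for all $x$, and let $\mathrm{Out}_B(E)=\mathrm{Aut}_B(E)/\mathrm{Inn}_B(E)$, with quotient map $p_E\colon\mathrm{Aut}_B(E)\to\mathrm{Out}_B(E)$. For CBERs $E\subseteq F$ on $X$: - $E$ is normal in $F$ if there is a countable subgroup $G\le\mathrm{Aut}_B(E)$ such that $x\mathrel{F}y\iff\exists g\in G\,(g(x)\mathrel{E}y)$ for all $x,y\in X$; - $F$ has finite index over $E$ if every $F$-class contains only finitely many $E$-classes; - an $(E,F)$-link is a CBER $L\subseteq F$ on $X$ such that, within each $F$-class, every $E$-class meets every $L$-class in exactly one point. Theorem. Let $X$ be a standard Borel space. (1) If $E\subseteq F$ are CBERs on $X$ such that $E$ is normal in $F$ and $F$ has finite index over $E$, then there is an $(E,F)$-link. (2) Every outer action of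 a finite group has a class-bijective lift: for every CBER $E$ on $X$, every finite group $G$ and every homomorphism $\varphi\colon G\to\mathrm{Out}_B(E)$, there is a homomorphism $\psi\colon G\to\mathrm{Aut}_B(E)$ with $p_E\circ\psi=\varphi$ such that, for all $g\in G$ and $x\in X$, $\psi(g)(x)\mathrel{E}x$ implies $\psi(g)(x)=x$. -/

import Mathlib

namespace CBER

universe u v

/-- A countable Borel equivalence relation on `X`: it is a Borel subset of `X × X`
and all its classes are countable. -/
structure IsCBER {X : Type u} [MeasurableSpace X] (E : Setoid X) : Prop where
  measurableSet : MeasurableSet {p : X × X | E p.1 p.2}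
  countable_class : ∀ x : X, {y : X | E x y}.Countable

/-- `Aut_B(E)`: the group of Borel automorphisms `T` of `X` with
`x E y ↔ T x E T y`. -/
def AutB {X : Type u} [MeasurableSpace X] (E : Setoid X) : Subgroup (Equiv.Perm X) where
  carrier := {T | Measurable T ∧ Measurable T.symm ∧ ∀ x y, E x y ↔ E (T x) (T y)}
  mul_mem' := by
    rintro S T ⟨hS, hS', hSE⟩ ⟨hT, hT', hTE⟩
    exact ⟨hS.comp hT, hT'.comp hS', fun x y => (hTE x y).trans (hSE _ _)⟩
  one_mem' := ⟨measurable_id, measurable_id, fun _ _ => Iff.rfl⟩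
  inv_mem' := by
    rintro T ⟨hT, hT', hTE⟩
    refine ⟨hT', hT, fun x y => ?_⟩
    have h := hTE (T.symm x) (T.symm y)
    rw [Equiv.apply_symm_apply, Equiv.apply_symm_apply] at h
    exact h.symm

/-- `Inn_B(E)`: the subgroup of those `T ∈ Aut_B(E)` with `x E T x` for all `x`. -/
def InnB {X : Type u} [MeasurableSpace X] (E : Setoid X) : Subgroup (AutB E) where
  carrier := {T | ∀ x, E x ((T : Equiv.Perm X) x)}
  mul_mem' := fun {S T} hS hT x => E.trans (hT x) (hS ((T : Equiv.Perm X) x))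
  one_mem' := fun x => E.refl x
  inv_mem' := by
    intro T hT x
    have h := hT ((T : Equiv.Perm X).symm x)
    rw [Equiv.apply_symm_apply] at h
    exact E.symm h

instance InnB.instNormal {X : Type u} [MeasurableSpace X] (E : Setoid X) :
    (InnB E).Normal where
  conj_mem := by
    intro T hT S x
    have h := (S.2.2.2 _ _).1 (hT ((S : Equiv.Perm X).symm x))
    rw [Equiv.apply_symm_apply] at h
    exact h

/-- `Out_B(E) = Aut_B(E) / Inn_B(E)`. -/
abbrev OutB {X : Type u} [MeasurableSpace X] (E : Setoid X) : Type u :=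
  AutB E ⧸ InnB E

/-- The quotient morphism `p_E : Aut_B(E) → Out_B(E)`. -/
def pE {X : Type u} [MeasurableSpace X] (E : Setoid X) : AutB E →* OutB E :=
  QuotientGroup.mk' (InnB E)

/-- The relation `E^{∨G}` for a subgroup `G` of `Aut_B(E)`:
`x` and `y` are related iff `g · [x]_E = [y]_E`, i.e. `g x E y`, for some `g ∈ G`. -/
def vee {X : Type u} [MeasurableSpace X] (E : Setoid X) (G : Subgroup (AutB E)) :
    Setoid X where
  r x y := ∃ g ∈ G, E ((g : Equiv.Perm X) x) y
  iseqv :=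
    { refl := fun x => ⟨1, G.one_mem, E.refl x⟩
      symm := by
        rintro x y ⟨g, hg, h⟩
        refine ⟨g⁻¹, G.inv_mem hg, ?_⟩
        have h' := ((g⁻¹).2.2.2 _ _).1 h
        have e : ((g⁻¹ : AutB E) : Equiv.Perm X) ((g : Equiv.Perm X) x) = x :=
          (g : Equiv.Perm X).symm_apply_apply x
        rw [e] at h'
        exact E.symm h'
      trans := by
        rintro x y z ⟨g, hg, h⟩ ⟨k, hk, h'⟩
        exact ⟨k * g, G.mul_mem hk hg, E.trans ((k.2.2.2 _ _).1 h) h'⟩ }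

/-- `E ⊲ F`: there is a countable subgroup `G ≤ Aut_B(E)` with `F = E^{∨G}`.
(In particular `E ⊆ F`.) -/
def IsNormalIn {X : Type u} [MeasurableSpace X] (E F : Setoid X) : Prop :=
  ∃ G : Subgroup (AutB E), Countable G ∧ F = vee E G

/-- `F` has finite index over `E`: every `F`-class contains only finitely many `E`-classes. -/
def HasFiniteIndexOver {X : Type u} (F E : Setoid X) : Prop :=
  ∀ x : X, {c : Set X | c ∈ E.classes ∧ c ⊆ {y | F x y}}.Finite

/-- `L` is an `(E,F)`-link: a countable Borel equivalence relation `L ⊆ F` such that within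
each `F`-class, every `E`-class meets every `L`-class in exactly one point. -/
structure IsLink {X : Type u} [MeasurableSpace X] (E F L : Setoid X) : Prop where
  isCBER : IsCBER L
  le : L ≤ F
  existsUnique : ∀ x y : X, F x y → ∃! z : X, E x z ∧ L y z

/-- `ψ : G → Aut_B(E)` is a lift of the outer action `φ : G → Out_B(E)`. -/
def IsLift {X : Type u} [MeasurableSpace X] {E : Setoid X} {G : Type v} [Group G]
    (φ : G →* OutB E) (ψ : G →* AutB E) : Prop :=
  (pE E).comp ψ = φ

/-- An action `G → Aut_B(E)` is class-bijective if `g · x E x` implies `g · x = x`, i.e. the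
quotient map `X → X/E` is injective on every orbit. -/
def IsClassBijective {X : Type u} [MeasurableSpace X] {E : Setoid X} {G : Type v} [Group G]
    (ψ : G →* AutB E) : Prop :=
  ∀ (g : G) (x : X), E ((ψ g : Equiv.Perm X) x) x → (ψ g : Equiv.Perm X) x = x

end CBER

namespace CBER

open Set Function MeasureTheory TopologicalSpace Filter Topology

/-! ### Lusin–Novikov uniformization for countable-to-one Borel maps. -/

section LusinNovikov

variable {Z X : Type*}

/-! Lusin–Novikov supplies the descriptive set theory: a countable-to-one Borel map is injective on
each of countably many Borel pieces (`exists_measurable_nat_injective`). Hence the transversals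
(tuples with one point from each `E`-class of an `F`-class) split into countably many Borel families
of pairwise disjoint ones. Taking blocks greedily from these families gives a partial link `K`. In
every `F`-class some `E`-class is fully covered by `K`: otherwise the uncovered points would contain
a transversal, which the greedy choice must have met (`exists_isPartialLink_covering`).

By normality each `E`-class embeds, by one automorphism, into a fully covered `E`-class of its
`F`-class, hence injects into the set of `K`-blocks there. The `K`-covered points of the class
correspond bijectively to the same blocks. Schröder–Bernstein turns this into a Borel bijection
between class and blocks, and pulling `K` back gives the link (`exists_isLink_of_seq`).

For (2), representatives of the outer action generate a finite index extension of `E`. Its link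
selects, in the `E`-class where `g` sends `x`, the unique point linked to `x`. -/

/-- An analytic set on which a continuous map is injective is contained in a Borel set with the
same property. -/
theorem exists_measurableSet_injOn_superset [TopologicalSpace Z] [PolishSpace Z]
    [MeasurableSpace Z] [BorelSpace Z] [TopologicalSpace X] [T2Space X] [MeasurableSpace X]
    [BorelSpace X] {p : Z → X} (hp : Continuous p) {A : Set Z} (hA : AnalyticSet A)
    (hinj : InjOn p A) : ∃ B, MeasurableSet B ∧ A ⊆ B ∧ InjOn p B := by
  let b := countableBasis Z
  have hsep : ∀ s t : b, Disjoint (s : Set Z) t →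
      MeasurablySeparable (p '' (A ∩ s)) (p '' (A ∩ t)) := by
    intro s t hst
    have han : ∀ u : b, AnalyticSet (p '' (A ∩ u)) := fun u => by
      have h : AnalyticSet (A ∩ (u : Set Z)) := by
        have h2 := (isOpen_of_mem_countableBasis u.2).measurableSet.analyticSet
        rw [inter_eq_iInter]
        exact AnalyticSet.iInter (by rintro (_ | _) <;> assumption)
      exact h.image_of_continuous hp
    refine (han s).measurablySeparable (han t) ?_
    rw [disjoint_left]
    rintro _ ⟨z, ⟨hz, hzs⟩, rfl⟩ ⟨w, ⟨hw, hwt⟩, hwz⟩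
    have := hinj hw hz hwz
    subst this
    exact disjoint_left.1 hst hzs hwt
  choose! C hC1 hC2 hC3 using hsep
  have : Countable b := (countable_countableBasis Z).to_subtype
  -- `C s t` is a Borel set separating `p '' (A ∩ s)` from `p '' (A ∩ t)`. Retain the points
  -- respecting all these separations: two distinct ones have disjoint basic neighbourhoods, so
  -- their images are separated.
  refine ⟨⋂ s : b, ⋂ t : b, {z | Disjoint (s : Set Z) t →
      (z ∈ (s : Set Z) → p z ∈ C s t) ∧ (z ∈ (t : Set Z) → p z ∉ C s t)}, ?_, ?_, ?_⟩
  · refine MeasurableSet.iInter fun s => MeasurableSet.iInter fun t => ?_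
    by_cases hst : Disjoint (s : Set Z) t
    · have h1 := (isOpen_of_mem_countableBasis s.2).measurableSet
      have h2 := (isOpen_of_mem_countableBasis t.2).measurableSet
      have h3 := hp.measurable (hC3 s t hst)
      simp only [hst, true_imp_iff]
      exact (h1.imp h3).inter (h2.imp h3.compl)
    · simp [hst]
  · intro z hz
    simp only [mem_iInter]
    intro s t hst
    exact ⟨fun h => hC1 s t hst ⟨z, ⟨hz, h⟩, rfl⟩,
      fun h h' => disjoint_left.1 (hC2 s t hst) ⟨z, ⟨hz, h⟩, rfl⟩ h'⟩
  · intro z hz w hw hzw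
    by_contra hne
    obtain ⟨u, v, hu, hv, hzu, hwv, huv⟩ := t2_separation hne
    obtain ⟨s, hs, hzs, hsu⟩ := (isBasis_countableBasis Z).exists_subset_of_mem_open hzu hu
    obtain ⟨t, ht, hwt, htv⟩ := (isBasis_countableBasis Z).exists_subset_of_mem_open hwv hv
    simp only [mem_iInter] at hz hw
    have hst : Disjoint s t := huv.mono hsu htv
    have h1 := (hz ⟨s, hs⟩ ⟨t, ht⟩ hst).1 hzs
    have h2 := (hw ⟨s, hs⟩ ⟨t, ht⟩ hst).2 hwt
    rw [hzw] at h1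
    exact h2 h1

/-- The fibre sequences of `p` in the box `U` are all hit by countably many Borel sets on which
`p` is injective. -/
def IsNullBox [MeasurableSpace Z] (p : Z → X) (U : ℕ → Set Z) : Prop :=
  ∃ B : ℕ → Set Z, (∀ n, MeasurableSet (B n) ∧ InjOn p (B n)) ∧
    ∀ γ : ℕ → Z, (∀ j, γ j ∈ U j) → (∀ j, p (γ j) = p (γ 0)) → ∃ j n, γ j ∈ B n

/-- The σ-ideal property of null boxes: countably many witnesses merge into one. -/
theorem exists_common_of_isNullBox [MeasurableSpace Z] {p : Z → X} {ι : Type*} [Countable ι]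
    {V : ι → ℕ → Set Z} (hV : ∀ i, IsNullBox p (V i)) :
    ∃ B : ℕ → Set Z, (∀ n, MeasurableSet (B n) ∧ InjOn p (B n)) ∧
      ∀ i, ∀ γ : ℕ → Z, (∀ j, γ j ∈ V i j) → (∀ j, p (γ j) = p (γ 0)) → ∃ j n, γ j ∈ B n := by
  choose B hB hγ using hV
  rcases isEmpty_or_nonempty ι with h | h
  · exact ⟨fun _ => ∅, by simp, fun i => isEmptyElim i⟩
  obtain ⟨e, he⟩ := exists_surjective_nat (ι × ℕ)
  refine ⟨fun n => B (e n).1 (e n).2, fun n => hB _ _, fun i γ h1 h2 => ?_⟩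
  obtain ⟨j, n, hn⟩ := hγ i γ h1 h2
  obtain ⟨m, hm⟩ := he (i, n)
  exact ⟨j, m, by simpa [hm] using hn⟩

/-- If all splittings by disjoint basic open sets were null, take a common witness `B`. Among fibre
sequences avoiding `B`, the `i`-th entries form an analytic set on which `p` is injective; a Borel
superset of it, added to `B`, would make `U` null. -/
theorem exists_split_of_not_isNullBox [TopologicalSpace Z] [PolishSpace Z]
    [MeasurableSpace Z] [BorelSpace Z] [TopologicalSpace X] [T2Space X]
    [SecondCountableTopology X] [MeasurableSpace X] [BorelSpace X] {p : Z → X}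
    (hp : Continuous p) {U : ℕ → Set Z} (hU : ∀ j, IsOpen (U j)) (hnull : ¬ IsNullBox p U)
    {i k : ℕ} (hik : i ≠ k) (hk : U k = univ) :
    ∃ V W : Set Z, IsOpen V ∧ IsOpen W ∧ Disjoint V W ∧ V ⊆ U i ∧ W ⊆ U i ∧
      ¬ IsNullBox p (update (update U i V) k W) := by
  by_contra! hcon
  let b := countableBasis Z
  have : Countable b := (countable_countableBasis Z).to_subtype
  have hV : ∀ q : {q : b × b // Disjoint (q.1 : Set Z) q.2},
      IsNullBox p (update (update U i (U i ∩ q.1.1)) k (U i ∩ q.1.2)) := fun q =>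
    hcon _ _ ((hU i).inter (isOpen_of_mem_countableBasis q.1.1.2))
      ((hU i).inter (isOpen_of_mem_countableBasis q.1.2.2))
      (q.2.mono inter_subset_right inter_subset_right) inter_subset_left inter_subset_left
  obtain ⟨B, hB, hBγ⟩ := exists_common_of_isNullBox hV
  let S : Set (ℕ → Z) := {γ | (∀ j, γ j ∈ U j) ∧ (∀ j, p (γ j) = p (γ 0)) ∧ ∀ j n, γ j ∉ B n}
  have hS : MeasurableSet S := by
    have h1 : ∀ j : ℕ, Measurable fun γ : ℕ → Z => γ j := fun j => measurable_pi_apply j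
    refine MeasurableSet.inter (s₁ := {γ : ℕ → Z | ∀ j, γ j ∈ U j}) ?_ (MeasurableSet.inter
      (s₁ := {γ : ℕ → Z | ∀ j, p (γ j) = p (γ 0)})
      (s₂ := {γ : ℕ → Z | ∀ j n, γ j ∉ B n}) ?_ ?_)
    · simp only [ofPred_forall]
      exact MeasurableSet.iInter fun j => h1 j (hU j).measurableSet
    · simp only [ofPred_forall]
      exact MeasurableSet.iInter fun j => measurableSet_eq_fun (hp.measurable.comp (h1 j))
        (hp.measurable.comp (h1 0))
    · simp only [ofPred_forall]
      exact MeasurableSet.iInter fun j => MeasurableSet.iInter fun n => h1 j (hB n).1.compl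
  have hA : AnalyticSet ((fun γ : ℕ → Z => γ i) '' S) :=
    hS.analyticSet_image (measurable_pi_apply i)
  have hinj : InjOn p ((fun γ : ℕ → Z => γ i) '' S) := by
    rintro _ ⟨γ, hγ, rfl⟩ _ ⟨δ, hδ, rfl⟩ hpe
    by_contra hne
    obtain ⟨u, v, hu, hv, hzu, hwv, huv⟩ := t2_separation hne
    obtain ⟨s, hs, hzs, hsu⟩ := (isBasis_countableBasis Z).exists_subset_of_mem_open hzu hu
    obtain ⟨t, ht, hwt, htv⟩ := (isBasis_countableBasis Z).exists_subset_of_mem_open hwv hv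
    -- Putting `δ i` at position `k` of `γ` gives a fibre sequence in a split box, so one of its
    -- entries lies in `B`, though neither `γ` nor `δ` meets `B`.
    obtain ⟨j, n, hjn⟩ := hBγ ⟨(⟨s, hs⟩, ⟨t, ht⟩), huv.mono hsu htv⟩ (update γ k (δ i))
      (by
        intro j
        rcases eq_or_ne j k with rfl | hj
        · simpa using ⟨hδ.1 i, hwt⟩
        rcases eq_or_ne j i with rfl | hji
        · simpa [hj] using ⟨hγ.1 j, hzs⟩
        · simpa [hj, hji] using hγ.1 j)
      (by
        have key : ∀ j, p (update γ k (δ i) j) = p (γ 0) := by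
          intro j
          rcases eq_or_ne j k with rfl | hj
          · simpa using hpe.symm.trans (hγ.2.1 i)
          · simpa [hj] using hγ.2.1 j
        intro j
        rw [key, key])
    rcases eq_or_ne j k with rfl | hj
    · exact hδ.2.2 i n (by simpa using hjn)
    · exact hγ.2.2 j n (by simpa [hj] using hjn)
  obtain ⟨C, hC, hAC, hCinj⟩ := exists_measurableSet_injOn_superset hp hA hinj
  refine hnull ⟨fun n => Nat.casesOn n C B, ?_, ?_⟩
  · rintro (_ | n)
    exacts [⟨hC, hCinj⟩, hB n]
  · intro γ h1 h2
    by_cases h3 : ∃ j n, γ j ∈ B n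
    · obtain ⟨j, n, h3⟩ := h3
      exact ⟨j, n + 1, h3⟩
    · push Not at h3
      exact ⟨i, 0, hAC ⟨γ, ⟨h1, h2, h3⟩, rfl⟩⟩

/-- Small basic sets with closure inside `U i` cover `U i`, and there are countably many; were all
the resulting boxes null, so would be `U`. -/
theorem exists_shrink_of_not_isNullBox [MetricSpace Z] [SecondCountableTopology Z]
    [MeasurableSpace Z] {p : Z → X} {U : ℕ → Set Z} {i : ℕ} (hU : IsOpen (U i))
    (hnull : ¬ IsNullBox p U) {ε : ℝ} (hε : 0 < ε) :
    ∃ V, IsOpen V ∧ closure V ⊆ U i ∧ (∀ x ∈ V, ∀ y ∈ V, dist x y ≤ ε) ∧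
      ¬ IsNullBox p (update U i V) := by
  by_contra! hcon
  let b := {v ∈ countableBasis Z | closure v ⊆ U i ∧ ∀ x ∈ v, ∀ y ∈ v, dist x y ≤ ε}
  have : Countable b := ((countable_countableBasis Z).mono (sep_subset _ _)).to_subtype
  obtain ⟨B, hB, hBγ⟩ := exists_common_of_isNullBox (V := fun v : b => update U i v)
    fun v => hcon v (isOpen_of_mem_countableBasis v.2.1) v.2.2.1 v.2.2.2
  refine hnull ⟨B, hB, fun γ h1 h2 => ?_⟩
  obtain ⟨r, hr, hrU⟩ := Metric.isOpen_iff.1 hU _ (h1 i)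
  obtain ⟨v, hv, hγv, hvs⟩ := (isBasis_countableBasis Z).exists_subset_of_mem_open
    (Metric.mem_ball_self (x := γ i) (ε := min (r / 2) (ε / 2)) (by positivity)) Metric.isOpen_ball
  have hd : ∀ x ∈ closure v, dist x (γ i) ≤ min (r / 2) (ε / 2) := fun x hx =>
    Metric.closure_ball_subset_closedBall (closure_mono hvs hx)
  refine hBγ ⟨v, hv, fun x hx => hrU ?_, fun x hx y hy => ?_⟩ γ (fun j => ?_) h2
  · have := (hd x hx).trans (min_le_left _ _)
    rw [Metric.mem_ball]
    linarith
  · have h3 := (hd x (subset_closure hx)).trans (min_le_right _ _)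
    have h4 := (hd y (subset_closure hy)).trans (min_le_right _ _)
    have := dist_triangle_right x y (γ i)
    linarith
  · rcases eq_or_ne j i with rfl | hj
    · simpa using hγv
    · simpa [hj] using h1 j

theorem exists_shrink_initial_of_not_isNullBox [MetricSpace Z] [SecondCountableTopology Z]
    [MeasurableSpace Z] {p : Z → X} {U : ℕ → Set Z} (hU : ∀ j, IsOpen (U j))
    (hnull : ¬ IsNullBox p U) {ε : ℝ} (hε : 0 < ε) (k : ℕ) :
    ∃ V : ℕ → Set Z, (∀ j, IsOpen (V j)) ∧ (∀ j < k, closure (V j) ⊆ U j) ∧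
      (∀ j < k, ∀ x ∈ V j, ∀ y ∈ V j, dist x y ≤ ε) ∧ (∀ j, k ≤ j → V j = U j) ∧
      ¬ IsNullBox p V := by
  induction k with
  | zero => exact ⟨U, hU, by simp, by simp, by simp, hnull⟩
  | succ k ih =>
    obtain ⟨V, hVo, hVc, hVd, hVU, hV⟩ := ih
    obtain ⟨W, hWo, hWc, hWd, hW⟩ := exists_shrink_of_not_isNullBox (hVo k) hV hε
    refine ⟨update V k W, fun j => ?_, fun j hj => ?_, fun j hj => ?_, fun j hj => ?_, hW⟩
    · rcases eq_or_ne j k with rfl | h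
      · simpa using hWo
      · simpa [h] using hVo j
    · rcases eq_or_ne j k with rfl | h
      · simpa [hVU j le_rfl] using hWc
      · simpa [h] using hVc j (by omega)
    · rcases eq_or_ne j k with rfl | h
      · simpa using hWd
      · simpa [h] using hVd j (by omega)
    · have h : j ≠ k := by omega
      simpa [h] using hVU j (by omega)

/-- One step in the construction of a perfect subset of a fibre. -/
theorem exists_split_shrink_of_not_isNullBox [MetricSpace Z] [CompleteSpace Z]
    [SecondCountableTopology Z] [MeasurableSpace Z] [BorelSpace Z] [TopologicalSpace X]
    [T2Space X] [SecondCountableTopology X] [MeasurableSpace X] [BorelSpace X] {p : Z → X}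
    (hp : Continuous p) {U : ℕ → Set Z} (hU : ∀ j, IsOpen (U j)) (hnull : ¬ IsNullBox p U)
    {i n : ℕ} (hi : i ≤ n) (hn : ∀ j, n < j → U j = univ) {ε : ℝ} (hε : 0 < ε) :
    ∃ V : ℕ → Set Z, (∀ j, IsOpen (V j)) ∧ ¬ IsNullBox p V ∧ (∀ j, n + 1 < j → V j = univ) ∧
      (∀ j ≤ n, closure (V j) ⊆ U j) ∧ closure (V (n + 1)) ⊆ U i ∧
      Disjoint (V i) (V (n + 1)) ∧ ∀ j ≤ n + 1, ∀ x ∈ V j, ∀ y ∈ V j, dist x y ≤ ε := by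
  have hik : i ≠ n + 1 := by omega
  obtain ⟨P, Q, hP, hQ, hPQ, hPU, hQU, hnull'⟩ :=
    exists_split_of_not_isNullBox hp hU hnull hik (hn _ (by omega))
  have hU' : ∀ j, IsOpen (update (update U i P) (n + 1) Q j) := by
    intro j
    rcases eq_or_ne j (n + 1) with rfl | h
    · simpa using hQ
    rcases eq_or_ne j i with rfl | h'
    · simpa [h] using hP
    · simpa [h, h'] using hU j
  obtain ⟨V, hVo, hVc, hVd, hVU, hV⟩ :=
    exists_shrink_initial_of_not_isNullBox hU' hnull' hε (n + 2)
  have hi' : closure (V i) ⊆ P := by simpa [hik] using hVc i (by omega)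
  have hn' : closure (V (n + 1)) ⊆ Q := by simpa using hVc (n + 1) (by omega)
  refine ⟨V, hVo, hV, fun j hj => ?_, fun j hj => ?_, hn'.trans hQU,
    hPQ.mono (subset_closure.trans hi') (subset_closure.trans hn'), fun j hj => hVd j (by omega)⟩
  · rw [hVU j (by omega), update_of_ne (by omega), update_of_ne (by omega), hn j (by omega)]
  · rcases eq_or_ne j i with rfl | h
    · exact hi'.trans hPU
    · have h2 : j ≠ n + 1 := by omega
      simpa [h, h2] using hVc j (by omega)

/-- Otherwise repeated splitting and shrinking yields limit points `z j` in a single fibre, none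
isolated among the others; that closed fibre then contains a Cantor set. -/
theorem isNullBox_univ_of_countable_fibers [MetricSpace Z] [CompleteSpace Z]
    [SecondCountableTopology Z] [MeasurableSpace Z] [BorelSpace Z] [TopologicalSpace X]
    [T2Space X] [SecondCountableTopology X] [MeasurableSpace X] [BorelSpace X] {p : Z → X}
    (hp : Continuous p) (hcount : ∀ x, (p ⁻¹' {x}).Countable) :
    IsNullBox p fun _ => univ := by
  by_contra hnull
  let St := {s : ℕ × (ℕ → Set Z) // (∀ j, IsOpen (s.2 j)) ∧ ¬ IsNullBox p s.2 ∧
    ∀ j, s.1 < j → s.2 j = univ}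
  -- Stage `n` has active coordinates `0, …, n` and splits number `(Nat.unpair n).1 ≤ n`, creating
  -- coordinate `n + 1`. Every coordinate is thereby split infinitely often.
  have step : ∀ s : St, ∃ t : St, t.1.1 = s.1.1 + 1 ∧
      (∀ j ≤ s.1.1, closure (t.1.2 j) ⊆ s.1.2 j) ∧
      closure (t.1.2 (s.1.1 + 1)) ⊆ s.1.2 (Nat.unpair s.1.1).1 ∧
      Disjoint (t.1.2 (Nat.unpair s.1.1).1) (t.1.2 (s.1.1 + 1)) ∧
      ∀ j ≤ s.1.1 + 1, ∀ x ∈ t.1.2 j, ∀ y ∈ t.1.2 j, dist x y ≤ 1 / ((s.1.1 : ℝ) + 1) := by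
    rintro ⟨⟨n, U⟩, hU, hUn, hUu⟩
    obtain ⟨V, h1, h2, h3, h4, h5, h6, h7⟩ := exists_split_shrink_of_not_isNullBox hp hU hUn
      (Nat.unpair_left_le n) hUu (ε := 1 / ((n : ℝ) + 1)) (by positivity)
    exact ⟨⟨(n + 1, V), h1, h2, h3⟩, rfl, h4, h5, h6, h7⟩
  choose next hnext using step
  let s : ℕ → St := fun n => next^[n] ⟨(0, fun _ => univ), fun _ => isOpen_univ, hnull, by simp⟩
  have hs : ∀ n, s (n + 1) = next (s n) := fun n => iterate_succ_apply' _ _ _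
  have hs1 : ∀ n, (s n).1.1 = n := by
    intro n
    induction n with
    | zero => rfl
    | succ n ih => rw [hs, (hnext _).1, ih]
  let U : ℕ → ℕ → Set Z := fun n => (s n).1.2
  have hclos : ∀ n, ∀ j ≤ n, closure (U (n + 1) j) ⊆ U n j := by
    intro n j hj
    have := (hnext (s n)).2.1 j (by rwa [hs1])
    rwa [← hs] at this
  have hnew : ∀ n, closure (U (n + 1) (n + 1)) ⊆ U n (Nat.unpair n).1 := by
    intro n
    have := (hnext (s n)).2.2.1
    rwa [← hs, hs1] at this
  have hdisj : ∀ n, Disjoint (U (n + 1) (Nat.unpair n).1) (U (n + 1) (n + 1)) := by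
    intro n
    have := (hnext (s n)).2.2.2.1
    rwa [← hs, hs1] at this
  have hdist : ∀ n, ∀ j ≤ n + 1, ∀ x ∈ U (n + 1) j, ∀ y ∈ U (n + 1) j,
      dist x y ≤ 1 / ((n : ℝ) + 1) := by
    intro n j hj
    have := (hnext (s n)).2.2.2.2 j (by rwa [hs1])
    rwa [← hs, hs1] at this
  have hmono : ∀ j n m, j ≤ n → n ≤ m → U m j ⊆ U n j := by
    intro j n m hj hnm
    induction m, hnm using Nat.le_induction with
    | base => exact subset_rfl
    | succ m hm ih => exact (subset_closure.trans (hclos m j (hj.trans hm))).trans ih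
  have hconf : ∀ n, ∃ γ : ℕ → Z, (∀ j, γ j ∈ U n j) ∧ ∀ j, p (γ j) = p (γ 0) := by
    intro n
    by_contra! h
    -- A box containing no fibre sequence is null, with empty witness sets.
    refine (s n).2.2.1 ⟨fun _ => ∅, by simp, fun γ h1 h2 => ?_⟩
    obtain ⟨j, hj⟩ := h γ h1
    exact absurd (h2 j) hj
  choose γ hγU hγp using hconf
  have hlim : ∀ j, ∃ z, Tendsto (fun n => γ n j) atTop (𝓝 z) := by
    intro j
    refine cauchySeq_tendsto_of_complete (Metric.cauchySeq_iff.2 fun ε hε => ?_)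
    obtain ⟨N, hN⟩ := exists_nat_one_div_lt hε
    refine ⟨max j N + 1, fun m hm n hn => lt_of_le_of_lt ?_ hN⟩
    have key : ∀ m ≥ max j N + 1, γ m j ∈ U (max j N + 1) j := fun m hm =>
      hmono j _ m (by omega) (by omega) (hγU m j)
    refine (hdist _ j (by omega) _ (key m hm) _ (key n hn)).trans ?_
    gcongr
    exact le_max_right _ _
  choose z hz using hlim
  have hzU : ∀ j n, j ≤ n → z j ∈ U n j := fun j n hj => hclos n j hj <|
    mem_closure_of_tendsto (hz j) <| (eventually_ge_atTop (n + 1)).mono fun m hm =>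
      hmono j (n + 1) m (by omega) hm (hγU m j)
  have hpz : ∀ j, p (z j) = p (z 0) := fun j =>
    tendsto_nhds_unique ((hp.tendsto _).comp (hz j))
      (((hp.tendsto _).comp (hz 0)).congr fun n => (hγp n j).symm)
  have hpre : Preperfect (range z) := by
    rw [preperfect_iff_nhds]
    rintro _ ⟨j, rfl⟩ V hV
    obtain ⟨ε, hε, hεV⟩ := Metric.mem_nhds_iff.1 hV
    obtain ⟨N, hN⟩ := exists_nat_one_div_lt hε
    -- A stage that splits coordinate `j`, late enough for the diameter of `U n j` to be below `ε`.
    let n := Nat.pair j (N + 1 + j)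
    have hn : N + 1 + j ≤ n := Nat.right_le_pair _ _
    have hnj : (Nat.unpair n).1 = j := by simp [n]
    refine ⟨z (n + 1), ⟨hεV ?_, mem_range_self _⟩, ?_⟩
    · have h1 : z (n + 1) ∈ U n j := by
        have := hnew n (subset_closure (hzU (n + 1) (n + 1) le_rfl))
        rwa [hnj] at this
      have h2 : z (n + 1) ∈ U (N + j + 1) j := hmono j _ n (by omega) (by omega) h1
      refine Metric.mem_ball.2 (lt_of_le_of_lt ((hdist (N + j) j (by omega) _ h2 _
        (hzU j _ (by omega))).trans ?_) hN)
      gcongr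
      omega
    · intro h
      have h1 := hdisj n
      rw [hnj] at h1
      exact disjoint_left.1 h1 (hzU j (n + 1) (by omega)) (h ▸ hzU (n + 1) (n + 1) le_rfl)
  obtain ⟨f, hf, -, hfinj⟩ := hpre.perfect_closure.exists_nat_bool_injection
    ((range_nonempty z).closure)
  have hsub : closure (range z) ⊆ p ⁻¹' {p (z 0)} :=
    closure_minimal (range_subset_iff.2 hpz) (isClosed_singleton.preimage hp)
  have hunc : ¬ Countable (ℕ → Bool) := by
    rw [← Cardinal.mk_le_aleph0_iff, not_le]
    simp [Cardinal.aleph0_lt_continuum]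
  have hc : (range f).Countable := (hcount _).mono (hf.trans hsub)
  have hc' : Countable (ℕ → Bool) := by
    have := hc.preimage_of_injOn hfinj.injOn
    rwa [preimage_range, countable_univ_iff] at this
  exact hunc hc'

/-- Lusin–Novikov: a countable-to-one Borel map between standard Borel spaces becomes injective
when paired with a suitable Borel map into `ℕ`. -/
theorem exists_measurable_nat_injective [MeasurableSpace Z] [StandardBorelSpace Z]
    [MeasurableSpace X] [StandardBorelSpace X] {p : Z → X} (hp : Measurable p)
    (hcount : ∀ x, (p ⁻¹' {x}).Countable) :
    ∃ c : Z → ℕ, Measurable c ∧ ∀ z w, p z = p w → c z = c w → z = w := by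
  have hnull : IsNullBox p fun _ => univ := by
    let := upgradeStandardBorel X
    obtain ⟨τ, hb, hpol⟩ := StandardBorelSpace.polish (α := Z)
    -- A finer Polish topology with the same Borel sets makes `p` continuous.
    obtain ⟨τ', hle, hcont, hpol'⟩ := hp.exists_continuous
    have hb' : @BorelSpace Z τ' _ := by
      refine @BorelSpace.mk Z τ' _ ?_
      rw [borel_eq_borel_of_le hpol' hpol hle]
      exact hb.measurable_eq
    let := τ'
    let := upgradeIsCompletelyMetrizable Z
    exact isNullBox_univ_of_countable_fibers hcont hcount
  obtain ⟨B, hB, hBγ⟩ := hnull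
  -- Applied to constant sequences, nullness says that the sets `B n` cover `Z`.
  have hcov : ∀ z, ∃ n, z ∈ B n := fun z => by
    obtain ⟨-, n, hn⟩ := hBγ (fun _ => z) (fun _ => mem_univ _) fun _ => rfl
    exact ⟨n, hn⟩
  classical
  refine ⟨fun z => Nat.find (hcov z), measurable_find _ fun n => (hB n).1, fun z w h1 h2 => ?_⟩
  refine (hB (Nat.find (hcov z))).2 (Nat.find_spec (hcov z)) ?_ h1
  dsimp only at h2
  rw [h2]
  exact Nat.find_spec (hcov w)

end LusinNovikov

end CBER

namespace CBER

open Set Function MeasureTheory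

/-! ### Borel images, projections and graphs. -/

section CountableToOne

variable {Z X : Type*} [MeasurableSpace Z] [StandardBorelSpace Z] [MeasurableSpace X]
  [StandardBorelSpace X]

theorem exists_measurable_nat_injOn {p : Z → X} (hp : Measurable p) {S : Set Z}
    (hS : MeasurableSet S) (hcount : ∀ x, {z ∈ S | p z = x}.Countable) :
    ∃ c : Z → ℕ, Measurable c ∧ ∀ z ∈ S, ∀ w ∈ S, p z = p w → c z = c w → z = w := by
  have := hS.standardBorel
  obtain ⟨c, hc, hinj⟩ := exists_measurable_nat_injective (p := fun z : S => p z)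
    (hp.comp measurable_subtype_coe) fun x => by
      refine ((hcount x).preimage_of_injOn (f := ((↑) : S → Z))
        Subtype.val_injective.injOn).mono ?_
      rintro z rfl
      exact ⟨z.2, rfl⟩
  obtain ⟨c', hc', hcc⟩ := (MeasurableEmbedding.subtype_coe hS).exists_measurable_extend hc
    fun _ => ⟨0⟩
  refine ⟨c', hc', fun z hz w hw h1 h2 => ?_⟩
  have h3 := congrFun hcc ⟨z, hz⟩
  have h4 := congrFun hcc ⟨w, hw⟩
  exact congrArg Subtype.val (hinj ⟨z, hz⟩ ⟨w, hw⟩ h1 (by rw [← h3, ← h4]; exact h2))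

/-- Countable-to-one Borel images of Borel sets are Borel. -/
theorem measurableSet_image_of_countable_fibers {p : Z → X} (hp : Measurable p) {S : Set Z}
    (hS : MeasurableSet S) (hcount : ∀ x, {z ∈ S | p z = x}.Countable) :
    MeasurableSet (p '' S) := by
  obtain ⟨c, hc, hinj⟩ := exists_measurable_nat_injOn hp hS hcount
  have : p '' S = ⋃ n, p '' (S ∩ c ⁻¹' {n}) := by
    rw [← image_iUnion, ← inter_iUnion, ← preimage_iUnion, iUnion_of_singleton, preimage_univ,
      inter_univ]
  rw [this]
  refine MeasurableSet.iUnion fun n => (hS.inter (hc (measurableSet_singleton n))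
    ).image_of_measurable_injOn hp ?_
  rintro z ⟨hz, hzn⟩ w ⟨hw, hwn⟩ h
  exact hinj z hz w hw h (hzn.trans hwn.symm)

/-- A projection of a Borel set with countable sections is Borel. -/
theorem measurableSet_exists_of_countable {P : Z → X → Prop}
    (hP : MeasurableSet {q : Z × X | P q.1 q.2}) (hcount : ∀ z, {x | P z x}.Countable) :
    MeasurableSet {z | ∃ x, P z x} := by
  have : {z | ∃ x, P z x} = Prod.fst '' {q : Z × X | P q.1 q.2} := by
    ext z
    simp
  rw [this]
  refine measurableSet_image_of_countable_fibers measurable_fst hP fun z => ?_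
  refine ((hcount z).image (Prod.mk z)).mono ?_
  rintro ⟨w, x⟩ ⟨h, rfl⟩
  exact ⟨x, h, rfl⟩

/-- A function with Borel graph is Borel. -/
theorem measurable_of_measurableSet_graph {P : Z → X → Prop}
    (hP : MeasurableSet {q : Z × X | P q.1 q.2}) {f : Z → X} (hf : ∀ z x, P z x ↔ x = f z) :
    Measurable f := by
  intro B hB
  have : f ⁻¹' B = Prod.fst '' ({q : Z × X | P q.1 q.2} ∩ Prod.snd ⁻¹' B) := by
    ext z
    simp [hf]
  rw [this]
  refine (hP.inter (measurable_snd hB)).image_of_measurable_injOn measurable_fst ?_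
  rintro ⟨z, x⟩ ⟨h1, -⟩ ⟨w, y⟩ ⟨h2, -⟩ h
  simp only [mem_ofPred_eq, hf] at h1 h2 h
  rw [h1, h2, h]

end CountableToOne

/-! ### Partial links built from disjoint transversals. -/

section PartialLink

variable {X : Type*} [MeasurableSpace X]

theorem IsCBER.measurableSet_rel {E : Setoid X} (hE : IsCBER E) {Z : Type*} [MeasurableSpace Z]
    {f g : Z → X} (hf : Measurable f) (hg : Measurable g) :
    MeasurableSet {z | E (f z) (g z)} :=
  (hf.prodMk hg) hE.measurableSet

/-- A Borel family of pairwise disjoint transversals for the `E`-classes in `F`-classes, given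
as the partial equivalence relation of lying in a common member of the family. -/
structure IsPartialLink (E F : Setoid X) (B : X → X → Prop) : Prop where
  measurableSet : MeasurableSet {q : X × X | B q.1 q.2}
  symm : ∀ {x y}, B x y → B y x
  trans : ∀ {x y z}, B x y → B y z → B x z
  le : ∀ {x y}, B x y → F x y
  eq_of_rel : ∀ {x y}, B x y → E x y → x = y
  exists_rel : ∀ {x y}, B x x → F x y → ∃ z, E y z ∧ B x z

/-- A tuple that meets each `E`-class in its `F`-class exactly once. -/
structure IsTransversal (E F : Setoid X) {n : ℕ} (t : Fin n → X) : Prop where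
  rel : ∀ i j, F (t i) (t j)
  eq_of_rel : ∀ i j, E (t i) (t j) → i = j
  exists_rel : ∀ i y, F (t i) y → ∃ j, E y (t j)

variable [StandardBorelSpace X] {E F : Setoid X}

/-- The only quantifier over `X` ranges over the countable `F`-class of `t i`, so it preserves
Borelness. -/
theorem measurableSet_isTransversal (hE : IsCBER E) (hF : IsCBER F) (n : ℕ) :
    MeasurableSet {t : Fin n → X | IsTransversal E F t} := by
  have hm : ∀ i : Fin n, Measurable fun t : Fin n → X => t i := measurable_pi_apply
  have h1 : MeasurableSet {t : Fin n → X | ∀ i j, F (t i) (t j)} := by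
    simp only [ofPred_forall]
    exact .iInter fun i => .iInter fun j => hF.measurableSet_rel (hm i) (hm j)
  have h2 : MeasurableSet {t : Fin n → X | ∀ i j, E (t i) (t j) → i = j} := by
    simp only [ofPred_forall]
    exact .iInter fun i => .iInter fun j =>
      (hE.measurableSet_rel (hm i) (hm j)).imp (MeasurableSet.const _)
  have h3 : MeasurableSet {t : Fin n → X | ∀ i, ¬ ∃ y, F (t i) y ∧ ∀ j, ¬ E y (t j)} := by
    rw [ofPred_forall]
    refine .iInter fun i => (measurableSet_exists_of_countable
      (P := fun (t : Fin n → X) y => F (t i) y ∧ ∀ j, ¬ E y (t j)) (MeasurableSet.inter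
      (s₁ := {q : (Fin n → X) × X | F (q.1 i) q.2})
      (s₂ := {q : (Fin n → X) × X | ∀ j, ¬ E q.2 (q.1 j)}) ?_ ?_) fun t => ?_).compl
    · exact hF.measurableSet_rel ((hm i).comp measurable_fst) measurable_snd
    · rw [ofPred_forall]
      exact .iInter fun j =>
        (hE.measurableSet_rel measurable_snd ((hm j).comp measurable_fst)).compl
    · exact (hF.countable_class (t i)).mono fun y hy => hy.1
  convert h1.inter (h2.inter h3) using 1
  ext t
  constructor
  · rintro ⟨a, b, c⟩
    refine ⟨a, b, fun i ⟨y, hy, h⟩ => ?_⟩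
    obtain ⟨j, hj⟩ := c i y hy
    exact h j hj
  · rintro ⟨a, b, c⟩
    refine ⟨a, b, fun i y hy => ?_⟩
    by_contra! h
    exact c i ⟨y, hy, h⟩

/-- Tuples from a Borel family of pairwise disjoint transversals form a partial link. -/
theorem isPartialLink_of_disjoint {n : ℕ} {T : Set (Fin n → X)} (hT : MeasurableSet T)
    (htr : ∀ t ∈ T, IsTransversal E F t)
    (hdisj : ∀ t ∈ T, ∀ s ∈ T, ∀ i j, t i = s j → t = s) :
    IsPartialLink E F fun x y => ∃ t ∈ T, ∃ i j, t i = x ∧ t j = y where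
  measurableSet := by
    have : {q : X × X | ∃ t ∈ T, ∃ i j, t i = q.1 ∧ t j = q.2} =
        ⋃ i, ⋃ j, (fun t : Fin n → X => (t i, t j)) '' T := by
      ext ⟨x, y⟩
      simp only [mem_ofPred_eq, mem_iUnion, mem_image, Prod.mk.injEq]
      tauto
    rw [this]
    refine .iUnion fun i => .iUnion fun j => hT.image_of_measurable_injOn
      ((measurable_pi_apply i).prodMk (measurable_pi_apply j)) ?_
    intro t ht s hs h
    exact hdisj t ht s hs i i (Prod.mk.inj h).1
  symm := by
    rintro x y ⟨t, ht, i, j, hi, hj⟩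
    exact ⟨t, ht, j, i, hj, hi⟩
  trans := by
    rintro x y z ⟨t, ht, i, j, hi, hj⟩ ⟨s, hs, k, l, hk, hl⟩
    obtain rfl := hdisj t ht s hs j k (hj.trans hk.symm)
    exact ⟨t, ht, i, l, hi, hl⟩
  le := by
    rintro x y ⟨t, ht, i, j, rfl, rfl⟩
    exact (htr t ht).rel i j
  eq_of_rel := by
    rintro x y ⟨t, ht, i, j, rfl, rfl⟩ h
    rw [(htr t ht).eq_of_rel i j h]
  exists_rel := by
    rintro x y ⟨t, ht, i, -, rfl, -⟩ h
    obtain ⟨j, hj⟩ := (htr t ht).exists_rel i y h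
    exact ⟨t j, hj, t, ht, i, j, rfl, rfl⟩

/-- The transversals are covered by countably many Borel families of pairwise disjoint
transversals. -/
theorem exists_seq_isPartialLink (hE : IsCBER E) (hF : IsCBER F) :
    ∃ B : ℕ → X → X → Prop, (∀ k, IsPartialLink E F (B k)) ∧
      ∀ (n : ℕ) (t : Fin n → X), IsTransversal E F t → ∃ k, ∀ i j, B k (t i) (t j) := by
  have hm : ∀ (n : ℕ) (i : Fin n), Measurable fun t : Fin n → X => t i :=
    fun n => measurable_pi_apply
  have hcol : ∀ (n : ℕ) (i : Fin n), ∃ c : (Fin n → X) → ℕ, Measurable c ∧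
      ∀ t ∈ {t | IsTransversal E F t}, ∀ s ∈ {t | IsTransversal E F t},
        t i = s i → c t = c s → t = s := fun n i =>
    exists_measurable_nat_injOn (hm n i) (measurableSet_isTransversal hE hF n) fun x => by
      refine (countable_univ_pi fun _ : Fin n => hF.countable_class x).mono ?_
      rintro t ⟨ht, rfl⟩ j -
      exact ht.rel i j
  choose c hc hcinj using hcol
  obtain ⟨e, he, heinj⟩ := MeasurableSpace.measurable_injection_nat_bool_of_countablySeparated X
  let ι := Σ n : ℕ, (Fin n → ℕ) × (Fin n → Fin n → ℕ × Bool)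
  -- Fixing the colours forces two tuples of a family that agree at one position to be equal. The
  -- fixed separating bits of `e` exclude `t i = s j` for `i ≠ j`.
  let T : (a : ι) → Set (Fin a.1 → X) := fun a => {t | IsTransversal E F t ∧
    (∀ i, c a.1 i t = a.2.1 i) ∧ ∀ i j, i ≠ j →
      e (t i) (a.2.2 i j).1 = (a.2.2 i j).2 ∧ e (t j) (a.2.2 i j).1 = !(a.2.2 i j).2}
  have hT : ∀ a, MeasurableSet (T a) := by
    rintro ⟨n, d, m⟩
    refine (measurableSet_isTransversal hE hF n).inter (MeasurableSet.inter
      (s₁ := {t : Fin n → X | ∀ i, c n i t = d i}) (s₂ := {t : Fin n → X | ∀ i j, i ≠ j →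
      e (t i) (m i j).1 = (m i j).2 ∧ e (t j) (m i j).1 = !(m i j).2}) ?_ ?_)
    · rw [ofPred_forall]
      exact .iInter fun i => hc n i (measurableSet_singleton _)
    · simp only [ofPred_forall]
      have h : ∀ (i : Fin n) (k : ℕ) (v : Bool), MeasurableSet {t : Fin n → X | e (t i) k = v} :=
        fun i k v => ((measurable_pi_apply k).comp (he.comp (hm n i))) (measurableSet_singleton v)
      exact .iInter fun i => .iInter fun j => .iInter fun _ => (h i _ _).inter (h j _ _)
  have hlink : ∀ a, IsPartialLink E F fun x y => ∃ t ∈ T a, ∃ i j, t i = x ∧ t j = y := by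
    intro a
    refine isPartialLink_of_disjoint (hT a) (fun t ht => ht.1) fun t ht s hs i j hij => ?_
    rcases eq_or_ne i j with rfl | hne
    · exact hcinj a.1 i t ht.1 s hs.1 hij ((ht.2.1 i).trans (hs.2.1 i).symm)
    · have h1 := (ht.2.2 i j hne).1
      have h2 := (hs.2.2 i j hne).2
      rw [hij, h2] at h1
      simp at h1
  obtain ⟨f, hf⟩ := exists_surjective_nat ι
  refine ⟨fun k x y => ∃ t ∈ T (f k), ∃ i j, t i = x ∧ t j = y, fun k => hlink (f k), ?_⟩
  intro n t ht
  have hsep : ∀ i j : Fin n, ∃ m : ℕ × Bool, i ≠ j →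
      e (t i) m.1 = m.2 ∧ e (t j) m.1 = !m.2 := by
    intro i j
    by_cases hij : i = j
    · exact ⟨(0, true), fun h => absurd hij h⟩
    have hne : e (t i) ≠ e (t j) := fun h =>
      hij (ht.eq_of_rel i j ((heinj h) ▸ E.refl _))
    obtain ⟨k, hk⟩ := Function.ne_iff.1 hne
    exact ⟨(k, e (t i) k), fun _ => ⟨rfl, Bool.eq_not.2 hk.symm⟩⟩
  choose m hmsep using hsep
  obtain ⟨k, hk⟩ := hf ⟨n, fun i => c n i t, m⟩
  have key : ∀ i j, ∃ s ∈ T ⟨n, fun i => c n i t, m⟩, ∃ i' j', s i' = t i ∧ s j' = t j :=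
    fun i j => ⟨t, ⟨ht, fun _ => rfl, hmsep⟩, i, j, rfl, rfl⟩
  exact ⟨k, by beta_reduce; rw [hk]; exact key⟩

/-- The points covered before stage `k` of the greedy choice of blocks. -/
def greedyCover (B : ℕ → X → X → Prop) : ℕ → Set X
  | 0 => ∅
  | k + 1 => greedyCover B k ∪ {x | B k x x ∧ ¬ ∃ y, B k x y ∧ y ∈ greedyCover B k}

/-- A block of `B k` is adopted at stage `k` unless it meets an earlier adopted block; in both cases
it meets `K`. -/
theorem exists_greedy_isPartialLink (hF : IsCBER F) {B : ℕ → X → X → Prop}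
    (hB : ∀ k, IsPartialLink E F (B k)) :
    ∃ K : X → X → Prop, IsPartialLink E F K ∧ ∀ k x, B k x x → ∃ y, B k x y ∧ K y y := by
  let C := greedyCover B
  have hrefl : ∀ {k x y}, B k x y → B k y y := fun {k x y} h => (hB k).trans ((hB k).symm h) h
  have hmeas : ∀ k, MeasurableSet (C k) → MeasurableSet {x | ∃ y, B k x y ∧ y ∈ C k} :=
    fun k hk => measurableSet_exists_of_countable
      ((hB k).measurableSet.inter (measurable_snd hk))
      fun x => (hF.countable_class x).mono fun y hy => (hB k).le hy.1
  have hC : ∀ k, MeasurableSet (C k) := by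
    intro k
    induction k with
    | zero => exact MeasurableSet.empty
    | succ k ih =>
      refine ih.union (MeasurableSet.inter (s₁ := {x | B k x x}) ?_ (hmeas k ih).compl)
      exact (measurable_id.prodMk measurable_id) (hB k).measurableSet
  have hmono : Monotone C := monotone_nat_of_le_succ fun k => subset_union_left
  let K : X → X → Prop := fun x y => ∃ k, B k x y ∧ ¬ ∃ z, B k x z ∧ z ∈ C k
  have hstage : ∀ {k x y}, B k x y → (¬ ∃ z, B k x z ∧ z ∈ C k) →
      ¬ ∃ z, B k y z ∧ z ∈ C k := by
    rintro k x y h h' ⟨z, hz, hzC⟩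
    exact h' ⟨z, (hB k).trans h hz, hzC⟩
  have hCK : ∀ k, ∀ y ∈ C k, K y y := by
    intro k
    induction k with
    | zero => exact fun y hy => hy.elim
    | succ k ih =>
      rintro y (hy | hy)
      exacts [ih y hy, ⟨k, hy⟩]
  refine ⟨K, ⟨?_, ?_, ?_, ?_, ?_, ?_⟩, fun k x hx => ?_⟩
  · have : {q : X × X | K q.1 q.2} = ⋃ k, {q : X × X | B k q.1 q.2} ∩
        Prod.fst ⁻¹' {x | ∃ y, B k x y ∧ y ∈ C k}ᶜ := by
      ext q
      simp [K]
    rw [this]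
    exact .iUnion fun k => (hB k).measurableSet.inter (measurable_fst (hmeas k (hC k)).compl)
  · rintro x y ⟨k, h, h'⟩
    exact ⟨k, (hB k).symm h, hstage h h'⟩
  · rintro x y z ⟨k, hk, hk'⟩ ⟨l, hl, hl'⟩
    have hyk : y ∈ C (k + 1) := Or.inr ⟨hrefl hk, hstage hk hk'⟩
    have hyl : y ∈ C (l + 1) := Or.inr ⟨(hB l).trans hl ((hB l).symm hl), hl'⟩
    -- A point in blocks adopted at two different stages would already be covered when the later one
    -- was adopted.
    rcases lt_trichotomy k l with hkl | rfl | hkl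
    · exact absurd ⟨y, (hB l).trans hl ((hB l).symm hl), hmono hkl hyk⟩ hl'
    · exact ⟨k, (hB k).trans hk hl, hk'⟩
    · exact absurd ⟨y, hk, hmono hkl hyl⟩ hk'
  · rintro x y ⟨k, h, -⟩
    exact (hB k).le h
  · rintro x y ⟨k, h, -⟩
    exact (hB k).eq_of_rel h
  · rintro x y ⟨k, h, h'⟩ hxy
    obtain ⟨z, hz, hxz⟩ := (hB k).exists_rel h hxy
    exact ⟨z, hz, k, hxz, h'⟩
  · by_cases h : ∃ y, B k x y ∧ y ∈ C k
    · obtain ⟨y, hy, hyC⟩ := h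
      exact ⟨y, hy, hCK k y hyC⟩
    · exact ⟨x, hx, k, hx, h⟩

/-- There is a partial link that fully covers some `E`-class in each `F`-class. -/
theorem exists_isPartialLink_covering (hE : IsCBER E) (hF : IsCBER F) (hEF : E ≤ F)
    (hfin : HasFiniteIndexOver F E) :
    ∃ K : X → X → Prop, IsPartialLink E F K ∧ ∀ x, ∃ y, F x y ∧ ∀ z, E y z → K z z := by
  obtain ⟨B, hB, hBt⟩ := exists_seq_isPartialLink hE hF
  obtain ⟨K, hK, hKB⟩ := exists_greedy_isPartialLink hF hB
  refine ⟨K, hK, fun x => ?_⟩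
  by_contra! hcon
  let S : Set (Set X) := {c | c ∈ E.classes ∧ c ⊆ {y | F x y}}
  have hSfin : Finite S := (hfin x).to_subtype
  obtain ⟨n, ⟨f⟩⟩ := Finite.exists_equiv_fin S
  -- Uncovered points, one from each of the finitely many `E`-classes, form a transversal that `K`
  -- misses.
  have hpt : ∀ a : S, ∃ z ∈ (a : Set X), ¬ K z z := by
    rintro ⟨_, ⟨y, rfl⟩, hsub⟩
    obtain ⟨z, hz, hzK⟩ := hcon y (hsub (E.refl y))
    exact ⟨z, E.symm hz, hzK⟩
  choose s hs hsK using hpt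
  have hFs : ∀ a, F x (s a) := fun a => a.2.2 (hs a)
  have hcl : ∀ y, F x y → ∃ a : S, E y (s a) := fun y hy => by
    let a : S := ⟨{z | E z y}, ⟨y, rfl⟩, fun z hz => F.trans hy (hEF (E.symm hz))⟩
    exact ⟨a, E.symm (hs a)⟩
  have ht : IsTransversal E F fun i => s (f.symm i) := by
    refine ⟨fun i j => F.trans (F.symm (hFs _)) (hFs _), fun i j hij => ?_, fun i y hy => ?_⟩
    · apply f.symm.injective
      obtain ⟨y, hy⟩ := (f.symm i).2.1
      obtain ⟨z, hz⟩ := (f.symm j).2.1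
      have hyi : E (s (f.symm i)) y := by
        have := hs (f.symm i)
        rwa [hy] at this
      have hzj : E (s (f.symm j)) z := by
        have := hs (f.symm j)
        rwa [hz] at this
      have hyz : E y z := E.trans (E.symm hyi) (E.trans hij hzj)
      apply Subtype.ext
      rw [hy, hz]
      ext w
      exact ⟨fun h => E.trans h hyz, fun h => E.trans h (E.symm hyz)⟩
    · obtain ⟨a, ha⟩ := hcl y (F.trans (hFs _) hy)
      exact ⟨f a, by simpa using ha⟩
  obtain ⟨k, hk⟩ := hBt n _ ht
  obtain ⟨a, -⟩ := hcl x (F.refl x)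
  obtain ⟨y, hy, hyK⟩ := hKB k _ (hk (f a) (f a))
  -- The covered point `y` of the block must be one of the chosen points, since a block meets each
  -- `E`-class only once.
  obtain ⟨z, hz, hyz⟩ : ∃ b : S, E y (s b) ∧ True := by
    obtain ⟨b, hb⟩ := hcl y (F.trans (hFs _) ((hB k).le hy))
    exact ⟨b, hb, trivial⟩
  have hky : B k y (s z) := by
    have := hk (f a) (f z)
    simp only [Equiv.symm_apply_apply] at this hy
    exact (hB k).trans ((hB k).symm hy) this
  exact hsK z ((hB k).eq_of_rel hky hz ▸ hyK)

end PartialLink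

end CBER

namespace CBER

open Set Function MeasureTheory

universe u

/-! ### From a partial link to a link by Schröder–Bernstein. -/

section Link

variable {X : Type u} [MeasurableSpace X]

theorem measurable_autB {E : Setoid X} (T : AutB E) : Measurable (T : Equiv.Perm X) := T.2.1

theorem autB_rel_iff {E : Setoid X} (T : AutB E) {x y : X} :
    E ((T : Equiv.Perm X) x) ((T : Equiv.Perm X) y) ↔ E x y := (T.2.2.2 x y).symm

variable [StandardBorelSpace X] {E F : Setoid X}

/-- If `F` is generated over `E` by countably many automorphisms of `E` and has finite index over
`E`, then there is an `(E,F)`-link. Starting from a partial link `K` with uncovered set `Y`, a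
Schröder–Bernstein argument in each `E`-class that meets `Y` produces a link. -/
theorem exists_isLink_of_seq (hE : IsCBER E) (hF : IsCBER F) (hEF : E ≤ F)
    (hfin : HasFiniteIndexOver F E) (T : ℕ → AutB E)
    (hT : ∀ x y, F x y ↔ ∃ n, E ((T n : Equiv.Perm X) x) y) : ∃ L, IsLink E F L := by
  classical
  obtain ⟨K, hK, hcov⟩ := exists_isPartialLink_covering hE hF hEF hfin
  let Y : Set X := {x | ¬ K x x}
  have hY : MeasurableSet Y := ((measurable_id.prodMk measurable_id) hK.measurableSet).compl
  -- The `E`-saturation of `Y`: its complement consists of the fully covered `E`-classes.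
  let D : Set X := {x | ∃ y, E x y ∧ y ∈ Y}
  have hD : MeasurableSet D := measurableSet_exists_of_countable
    (hE.measurableSet.inter (measurable_snd hY))
    fun x => (hE.countable_class x).mono fun y hy => hy.1
  have hDinv : ∀ {x y}, E x y → (x ∈ D ↔ y ∈ D) := fun h =>
    ⟨fun ⟨z, hz, hzY⟩ => ⟨z, E.trans (E.symm h) hz, hzY⟩,
      fun ⟨z, hz, hzY⟩ => ⟨z, E.trans h hz, hzY⟩⟩
  have hYD : Y ⊆ D := fun x hx => ⟨x, E.refl x, hx⟩
  have hex : ∀ x, ∃ n, (T n : Equiv.Perm X) x ∉ D := by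
    intro x
    obtain ⟨y, hy, hyK⟩ := hcov x
    obtain ⟨n, hn⟩ := (hT x y).1 hy
    refine ⟨n, fun h => ?_⟩
    obtain ⟨z, hz, hzY⟩ := (hDinv hn).1 h
    exact hzY (hyK z hz)
  -- The least index is constant on `E`-classes because `D` is `E`-invariant, so on each class `σ`
  -- is a single automorphism.
  let σ : X → X := fun x => (T (Nat.find (hex x)) : Equiv.Perm X) x
  have hσ : Measurable σ := Measurable.find (fun n => (measurable_autB (T n)))
    (fun n => (measurable_autB (T n)) hD.compl) hex
  have hσD : ∀ x, σ x ∉ D := fun x => Nat.find_spec (hex x)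
  have hσK : ∀ x, K (σ x) (σ x) := fun x => by
    by_contra h
    exact hσD x (hYD h)
  have hσF : ∀ x, F x (σ x) := fun x => (hT _ _).2 ⟨_, E.refl _⟩
  have hfind : ∀ {x y}, E x y → Nat.find (hex x) = Nat.find (hex y) := fun h =>
    Nat.find_congr' fun {n} => not_congr (hDinv ((autB_rel_iff (T n)).2 h))
  have hσE : ∀ {x y}, E x y → E (σ x) (σ y) := fun {x y} h => by
    simp only [σ, hfind h]
    exact (autB_rel_iff (T _)).2 h
  have hσinj : ∀ {x y}, E x y → σ x = σ y → x = y := fun {x y} h he => by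
    simp only [σ, hfind h] at he
    exact (T _ : Equiv.Perm X).injective he
  -- `κ x` is the point where the `K`-block of `σ x` returns to the `E`-class of `x`; it injects
  -- each class into its covered part.
  have hκex : ∀ x, ∃ z, E x z ∧ K (σ x) z := fun x => hK.exists_rel (hσK x) (F.symm (hσF x))
  choose κ hκE hκK using hκex
  have hκ_unique : ∀ {x z}, E x z → K (σ x) z → z = κ x := fun {x z} h h' =>
    hK.eq_of_rel (hK.trans (hK.symm h') (hκK x)) (E.trans (E.symm h) (hκE x))
  have hκ : Measurable κ := by
    refine measurable_of_measurableSet_graph (P := fun x z => E x z ∧ K (σ x) z)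
      (hE.measurableSet.inter (((hσ.comp measurable_fst).prodMk measurable_snd)
        hK.measurableSet)) fun x z => ⟨fun h => hκ_unique h.1 h.2, ?_⟩
    rintro rfl
    exact ⟨hκE x, hκK x⟩
  have hκinj : Injective κ := by
    intro x y h
    have hxy : E x y := E.trans (hκE x) (h ▸ E.symm (hκE y))
    refine hσinj hxy (hK.eq_of_rel (hK.trans (hκK x) ?_) (hσE hxy))
    rw [h]
    exact hK.symm (hκK y)
  -- The Schröder–Bernstein set: `κ` maps `A` onto its covered part `A \ Y`. Using the block of `σ
  -- x` on `A` and that of `x` off `A` therefore hits every block once per `E`-class.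
  let A : Set X := ⋃ n, κ^[n] '' Y
  have hA : MeasurableSet A := .iUnion fun n =>
    hY.image_of_measurable_injOn (hκ.iterate n) (hκinj.iterate n).injOn
  have hYA : Y ⊆ A := fun x hx => mem_iUnion.2 ⟨0, x, hx, rfl⟩
  have hκA : ∀ {x}, x ∈ A → κ x ∈ A := fun {x} hx => by
    obtain ⟨n, y, hy, rfl⟩ := mem_iUnion.1 hx
    exact mem_iUnion.2 ⟨n + 1, y, hy, iterate_succ_apply' _ _ _⟩
  have hApre : ∀ {x}, x ∈ A → K x x → ∃ u ∈ A, κ u = x := fun {x} hx hxK => by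
    obtain ⟨n, y, hy, rfl⟩ := mem_iUnion.1 hx
    rcases n with _ | n
    · exact absurd hxK hy
    · exact ⟨κ^[n] y, mem_iUnion.2 ⟨n, y, hy, rfl⟩, (iterate_succ_apply' _ _ _).symm⟩
  let τ : X → X := fun x => if x ∈ A then σ x else x
  have hτ : Measurable τ := hσ.ite hA measurable_id
  have hτA : ∀ {x}, x ∈ A → τ x = σ x := fun hx => if_pos hx
  have hτA' : ∀ {x}, x ∉ A → τ x = x := fun hx => if_neg hx
  have hτK : ∀ x, K (τ x) (τ x) := fun x => by
    by_cases hx : x ∈ A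
    · rw [hτA hx]
      exact hσK x
    · rw [hτA' hx]
      by_contra h
      exact hx (hYA h)
  have hτF : ∀ x, F x (τ x) := fun x => by
    by_cases hx : x ∈ A
    · rw [hτA hx]
      exact hσF x
    · rw [hτA' hx]
  let L : Setoid X := ⟨fun x y => K (τ x) (τ y), hτK, hK.symm, hK.trans⟩
  have hLF : L ≤ F := fun {x y} h => F.trans (hτF x) (F.trans (hK.le h) (F.symm (hτF y)))
  refine ⟨L, ⟨?_, fun x => (hF.countable_class x).mono fun y hy => hLF hy⟩, hLF, ?_⟩
  · exact ((hτ.comp measurable_fst).prodMk (hτ.comp measurable_snd)) hK.measurableSet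
  intro x y hxy
  -- If `z ∈ A` and `z' ∉ A` shared a block, then `z' = κ z`, which lies in `A`.
  have hmix : ∀ {z z'}, E z z' → K (τ z) (τ z') → z ∈ A → z' ∈ A := fun {z z'} h h' hz => by
    by_contra hz'
    rw [hτA hz, hτA' hz'] at h'
    exact hz' (hκ_unique h h' ▸ hκA hz)
  refine existsUnique_of_exists_of_unique ?_ ?_
  · obtain ⟨z, hz, hyz⟩ := hK.exists_rel (hτK y) (F.symm (F.trans hxy (hτF y)))
    by_cases hzA : z ∈ A
    · obtain ⟨w, hw, rfl⟩ := hApre hzA (hK.trans (hK.symm hyz) hyz)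
      refine ⟨w, E.trans hz (E.symm (hκE w)), ?_⟩
      change K (τ y) (τ w)
      rw [hτA hw]
      exact hK.trans hyz (hK.symm (hκK w))
    · refine ⟨z, hz, ?_⟩
      change K (τ y) (τ z)
      rwa [hτA' hzA]
  · rintro z z' ⟨hz, hyz⟩ ⟨hz', hyz'⟩
    have h : E z z' := E.trans (E.symm hz) hz'
    have h' : K (τ z) (τ z') := hK.trans (hK.symm hyz) hyz'
    by_cases hzA : z ∈ A
    · have hzA' := hmix h h' hzA
      rw [hτA hzA, hτA hzA'] at h'
      exact hσinj h (hK.eq_of_rel h' (hσE h))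
    · have hzA' : z' ∉ A := fun hc => hzA (hmix (E.symm h) (hK.symm h') hc)
      rw [hτA' hzA, hτA' hzA'] at h'
      exact hK.eq_of_rel h' h

/-- Stated for a countable family, since representatives of an outer action need not form a
subgroup. -/
theorem exists_isLink (hE : IsCBER E) (hF : IsCBER F) (hfin : HasFiniteIndexOver F E)
    {ι : Type*} [Countable ι] [Nonempty ι] (T : ι → AutB E)
    (hT : ∀ x y, F x y ↔ ∃ i, E ((T i : Equiv.Perm X) x) y) : ∃ L, IsLink E F L := by
  obtain ⟨f, hf⟩ := exists_surjective_nat ι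
  refine exists_isLink_of_seq hE hF (fun {x y} h => ?_) hfin (T ∘ f) fun x y => ?_
  · obtain ⟨i, hi⟩ := (hT x x).1 (F.refl x)
    exact (hT x y).2 ⟨i, E.trans hi h⟩
  · rw [hT, hf.exists]
    rfl

theorem exists_isLink_of_isNormalIn (hE : IsCBER E) (hF : IsCBER F) (hEF : IsNormalIn E F)
    (hfin : HasFiniteIndexOver F E) : ∃ L, IsLink E F L := by
  obtain ⟨G, hG, rfl⟩ := hEF
  refine exists_isLink hE hF hfin (fun g : G => (g : AutB E)) fun x y => ?_
  change (∃ g ∈ G, _) ↔ _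
  simp

end Link

/-! ### Lifting outer actions of finite groups. -/

section Lift

variable {X : Type u} [MeasurableSpace X] {E : Setoid X}

theorem pE_eq_iff (S T : AutB E) :
    pE E S = pE E T ↔ ∀ x, E ((S : Equiv.Perm X) x) ((T : Equiv.Perm X) x) := by
  have h : pE E S = pE E T ↔ S⁻¹ * T ∈ InnB E := QuotientGroup.eq
  rw [h]
  refine forall_congr' fun x => ?_
  rw [← autB_rel_iff S (x := x)]
  have : (S : Equiv.Perm X) (((S⁻¹ * T : AutB E) : Equiv.Perm X) x) = (T : Equiv.Perm X) x :=
    (S : Equiv.Perm X).apply_symm_apply _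
  rw [this]

theorem rel_one_of_pE_eq {G : Type*} [Group G] {φ : G →* OutB E} {T : G → AutB E}
    (hT : ∀ g, pE E (T g) = φ g) (x : X) : E ((T 1 : Equiv.Perm X) x) x := by
  have h : pE E (T 1) = pE E 1 := (hT 1).trans ((map_one φ).trans (map_one (pE E)).symm)
  exact (pE_eq_iff _ _).1 h x

theorem rel_mul_of_pE_eq {G : Type*} [Group G] {φ : G →* OutB E} {T : G → AutB E}
    (hT : ∀ g, pE E (T g) = φ g) (g h : G) (x : X) : E ((T (g * h) : Equiv.Perm X) x)
      ((T g : Equiv.Perm X) ((T h : Equiv.Perm X) x)) := by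
  have h : pE E (T (g * h)) = pE E (T g * T h) := by
    rw [hT, MonoidHom.map_mul, MonoidHom.map_mul, hT, hT]
  exact (pE_eq_iff _ _).1 h x

/-- The relation generated by `E` and automorphisms `T g` representing an outer action. -/
def orbitSetoid {G : Type*} [Group G] {φ : G →* OutB E} {T : G → AutB E}
    (hT : ∀ g, pE E (T g) = φ g) : Setoid X where
  r x y := ∃ g, E ((T g : Equiv.Perm X) x) y
  iseqv := by
    refine ⟨fun x => ⟨1, rel_one_of_pE_eq hT x⟩, ?_, ?_⟩
    · rintro x y ⟨g, hg⟩
      refine ⟨g⁻¹, E.trans ((autB_rel_iff (T g⁻¹)).2 (E.symm hg)) ?_⟩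
      refine E.trans (E.symm (rel_mul_of_pE_eq hT _ _ _)) ?_
      rw [inv_mul_cancel]
      exact rel_one_of_pE_eq hT x
    · rintro x y z ⟨g, hg⟩ ⟨h, hh⟩
      exact ⟨h * g, E.trans (rel_mul_of_pE_eq hT _ _ _) (E.trans ((autB_rel_iff (T h)).2 hg) hh)⟩

variable [StandardBorelSpace X]

theorem exists_isLift_isClassBijective (hE : IsCBER E) {G : Type*} [Group G] [Finite G]
    (φ : G →* OutB E) : ∃ ψ : G →* AutB E, IsLift φ ψ ∧ IsClassBijective ψ := by
  have hsurj : ∀ g, ∃ S : AutB E, pE E S = φ g := fun g =>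
    QuotientGroup.mk'_surjective (InnB E) (φ g)
  choose T hT using hsurj
  let F : Setoid X := orbitSetoid hT
  have hF : IsCBER F := by
    refine ⟨?_, fun x => ?_⟩
    · change MeasurableSet {q : X × X | ∃ g, E ((T g : Equiv.Perm X) q.1) q.2}
      rw [ofPred_exists]
      exact .iUnion fun g =>
        hE.measurableSet_rel ((measurable_autB (T g)).comp measurable_fst) measurable_snd
    · change {y | ∃ g, E ((T g : Equiv.Perm X) x) y}.Countable
      rw [ofPred_exists]
      exact countable_iUnion fun g => hE.countable_class _
  have hfin : HasFiniteIndexOver F E := by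
    intro x
    refine (finite_range fun g => {z | E z ((T g : Equiv.Perm X) x)}).subset ?_
    rintro _ ⟨⟨y, rfl⟩, hsub⟩
    obtain ⟨g, hg⟩ : F x y := hsub (E.refl y)
    refine ⟨g, ?_⟩
    ext z
    exact ⟨fun h => E.trans h hg, fun h => E.trans h (E.symm hg)⟩
  obtain ⟨L, hL⟩ := exists_isLink hE hF hfin T fun x y => Iff.rfl
  have hu : ∀ g x, ∃! z, E ((T g : Equiv.Perm X) x) z ∧ L x z := fun g x =>
    hL.existsUnique _ _ (F.symm ⟨g, E.refl _⟩)
  choose f hf hfu using hu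
  have hfE : ∀ g x, E ((T g : Equiv.Perm X) x) (f g x) := fun g x => (hf g x).1
  have hfL : ∀ g x, L x (f g x) := fun g x => (hf g x).2
  -- Both sides lie in the `L`-class of `x` and in the `E`-class of `T (g * h) x`, which share only
  -- one point.
  have hf_mul : ∀ g h x, f g (f h x) = f (g * h) x := fun g h x =>
    hfu _ _ _ ⟨E.trans (rel_mul_of_pE_eq hT g h x) (E.trans ((autB_rel_iff (T g)).2 (hfE h x)) (hfE g _)),
      L.trans (hfL h x) (hfL g _)⟩
  have hf_of_rel : ∀ g x, E (f g x) x → f g x = x := fun g x h => by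
    have h1 := hfu g x x ⟨E.trans (hfE g x) h, L.refl x⟩
    exact h1.symm
  have hf_one : ∀ x, f 1 x = x := fun x =>
    hf_of_rel 1 x (E.trans (E.symm (hfE 1 x)) (rel_one_of_pE_eq hT x))
  have hf_meas : ∀ g, Measurable (f g) := fun g =>
    measurable_of_measurableSet_graph
      (P := fun x z => E ((T g : Equiv.Perm X) x) z ∧ L x z)
      ((hE.measurableSet_rel ((measurable_autB (T g)).comp measurable_fst) measurable_snd).inter
        hL.isCBER.measurableSet)
      fun x z => ⟨fun h => hfu g x z h, fun h => h ▸ hf g x⟩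
  let e : G → Equiv.Perm X := fun g =>
    ⟨f g, f g⁻¹, fun x => by rw [hf_mul, inv_mul_cancel, hf_one],
      fun x => by rw [hf_mul, mul_inv_cancel, hf_one]⟩
  have he : ∀ g, e g ∈ AutB E := fun g => ⟨hf_meas g, hf_meas g⁻¹, fun x y =>
    ⟨fun h => E.trans (E.symm (hfE g x)) (E.trans ((autB_rel_iff (T g)).2 h) (hfE g y)),
      fun h => (autB_rel_iff (T g)).1 (E.trans (hfE g x) (E.trans h (E.symm (hfE g y))))⟩⟩
  let ψ : G →* AutB E := MonoidHom.mk' (fun g => ⟨e g, he g⟩) fun g h =>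
    Subtype.ext (Equiv.ext fun x => (hf_mul g h x).symm)
  refine ⟨ψ, MonoidHom.ext fun g => ?_, hf_of_rel⟩
  change pE E (ψ g) = φ g
  rw [← hT, pE_eq_iff]
  exact fun x => E.symm (hfE g x)

end Lift

end CBER

theorem mainTheorem8 {X : Type*} [MeasurableSpace X] [StandardBorelSpace X] :
    (∀ E F : Setoid X, CBER.IsCBER E → CBER.IsCBER F →
      CBER.IsNormalIn E F → CBER.HasFiniteIndexOver F E →
        ∃ L : Setoid X, CBER.IsLink E F L) ∧
    (∀ E : Setoid X, CBER.IsCBER E → ∀ (G : Type*) [Group G] [Finite G]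
      (φ : G →* CBER.OutB E),
        ∃ ψ : G →* CBER.AutB E, CBER.IsLift φ ψ ∧ CBER.IsClassBijective ψ) :=
  ⟨fun _ _ hE hF hEF hfin => CBER.exists_isLink_of_isNormalIn hE hF hEF hfin,
    fun _ hE _ _ _ φ => CBER.exists_isLift_isClassBijective hE φ⟩
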